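/- The quotient complexity $\kappa(L)$ of a language $L\subseteq\Sigma^*$ is the number of its distinct left quotients $\{x\in\Sigma^* \mid wx\in L\}$, $w\in\Sigma^*$. Star-free languages are the members of the smallest class that contains the finite languages and is closed under the boolean operations and concatenation. A DFA is aperiodic if no word performs a permutation, other than the identity permutation, of a subset of its set of states. Alphabets are finite and non-empty. For every $n\ge 2$ there is a star-free language $L$ over the four-letter alphabet $\{a,b,c,d\}$ with $\kappa(L)=n$ and $\kappa(L^*)=2^{n-1}+2^{n-2}$. For every $n\ge 3$ a witness is the language accepted by the aperiodic DFA ${\mathcal D}_n(a,b,c,d)$ with states $1,\dots,n$, initial state $1$, single accepting state $n-1$, and transitions $\delta(i,a)=\min(i+1,n)$; $\delta(i,b)=\max(i-1,1)$; $\delta(i,c)=\max(i-1,1)$ for $i\le n-1$ and $\delta(n,c)=n$; $\delta(i,d)=n$. The value $2^{n-1}+2^{n-2}$ is also the upper bound for regular languages: if $n\ge 2$ and $L$ is a regular language over any alphabet with $\kappa(L)=n$, then $\kappa(L^*)\le 2^{n-1}+2^{n-2}$. For $n=1$ the tight upper bound is $2$: over every alphabet, $2$ is the maximum of $\kappa(L^*)$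 over all star-free languages $L$ with $\kappa(L)=1$. -/

import Mathlib

open scoped Computability

/-- The star-free languages over an alphabet: the smallest class of languages that contains the
finite languages and is closed under the boolean operations and concatenation (closure under
intersection, difference and symmetric difference follows from union and complement). -/
inductive IsStarFree {α : Type*} : Language α → Prop
  | finite (L : Language α) (hL : Set.Finite {w : List α | w ∈ L}) : IsStarFree L
  | union (K L : Language α) (hK : IsStarFree K) (hL : IsStarFree L) : IsStarFree (K + L)
  | compl (L : Language α) (hL : IsStarFree L) : IsStarFree Lᶜ
  | concat (K L : Language α) (hK : IsStarFree K) (hL : IsStarFree L) : IsStarFree (K * L)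

/-- The quotient complexity of a language: the number (possibly infinite) of its distinct left
quotients by words. -/
noncomputable def quotientComplexity {α : Type*} (L : Language α) : ℕ∞ :=
  (Set.range L.leftQuotient).encard

/-- A DFA is aperiodic if no word performs a permutation, other than the identity permutation, of
a subset of the set of states. -/
def IsAperiodicDFA {α σ : Type*} (M : DFA α σ) : Prop :=
  ∀ (w : List α) (S : Set σ), Set.BijOn (fun q => M.evalFrom q w) S S →
    ∀ q ∈ S, M.evalFrom q w = q

/-- The four-letter alphabet `{a, b, c, d}`. -/
inductive Letter : Type
  | a
  | b
  | c
  | d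

/-- The transition function of the `n`-state witness automaton. The state `i : Fin n` (so
`0 ≤ i ≤ n - 1`) stands for the state `i + 1` of `{1, …, n}`. The letter `a` moves one state up
(the last state is fixed), `b` moves one state down (the first state is fixed), `c` moves one
state down but fixes both the first and the last state, and `d` moves every state to the last. -/
def starWitnessStep {n : ℕ} (i : Fin n) : Letter → Fin n
  | .a => ⟨min (i.val + 1) (n - 1), by have := i.isLt; omega⟩
  | .b => ⟨i.val - 1, by have := i.isLt; omega⟩
  | .c => if i.val = n - 1 then i else ⟨i.val - 1, by have := i.isLt; omega⟩
  | .d => ⟨n - 1, by have := i.isLt; omega⟩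

/-- The automaton `D_n(a, b, c, d)`, for `n ≥ 3`: the initial state is the first one, and the only
accepting state is the last but one. -/
def starWitness (n : ℕ) (hn : 3 ≤ n) : DFA Letter (Fin n) where
  step := starWitnessStep
  start := ⟨0, by omega⟩
  accept := {⟨n - 2, by omega⟩}

-- Write `L` for the language of a DFA with initial state `s`. Running all decompositions of the
-- input into factors of `L` in parallel gives the subset automaton `iterSubset`, which adds `s`
-- whenever an accepting state is hit. It decides `L∗` on nonempty words, and its reachable sets are
-- nonempty and contain `s` as soon as they contain a given accepting state `f`. If `f ≠ s`, there
-- are `2^(n-1) + 2^(n-2) - 1` such sets (`encard_guardedSets`); the quotient by the empty word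
-- contributes one more. If no accepting state of the minimal DFA differs from `s`, then `L∗ = L` or
-- `L` is empty. This is the upper bound `quotientComplexity_kstar_le`.
--
-- The bound is attained when all these sets are reached by nonempty words, are pairwise
-- distinguishable, and none of them accepts exactly `L∗` (`DFA.quotientComplexity_kstar_eq`). For
-- the witness, reachability is the main work (`StarReachable.of_mem`): `d` collapses everything to
-- the last state, and short words in `a`, `b`, `c` then insert single states and shift sets.
--
-- All letters of the witness act monotonically, which forces aperiodicity
-- (`IsAperiodicDFA.of_monotone`). Star-freeness then follows from Schützenberger's theorem, proved
-- here by local divisors: a word is cut at the occurrences of a letter `c` whose value is not `1`,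
-- and the values of the blocks are read as a word over the monoid, to be evaluated in the strictly
-- smaller local divisor at that value (`isStarFree_valueLanguage`).
--
-- The case `n = 2` uses a separate two-state automaton; for `n = 1` only the empty and the full
-- language occur.

universe u

/-! ### Closure properties of star-free languages. -/

namespace IsStarFree

variable {α : Type*}

theorem zero : IsStarFree (0 : Language α) :=
  .finite _ (by simp [Language.notMem_zero])

theorem top : IsStarFree (⊤ : Language α) := by
  have h : ((0 : Language α)ᶜ) = ⊤ := compl_bot
  exact h ▸ zero.compl

theorem congr {K L : Language α} (hK : IsStarFree K) (h : ∀ w, w ∈ L ↔ w ∈ K) : IsStarFree L :=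
  (Language.ext h : L = K) ▸ hK

theorem singleton (w : List α) : IsStarFree ({w} : Language α) :=
  .finite _ (Set.finite_singleton w)

theorem inf {K L : Language α} (hK : IsStarFree K) (hL : IsStarFree L) : IsStarFree (K ⊓ L) := by
  have h : ((Kᶜ + Lᶜ)ᶜ : Language α) = K ⊓ L := by
    ext w
    change ¬ (¬ (w ∈ K) ∨ ¬ (w ∈ L)) ↔ w ∈ K ∧ w ∈ L
    tauto
  exact h ▸ (hK.compl.union _ _ hL.compl).compl

theorem biUnion {ι : Type*} {S : Set ι} (hS : S.Finite) {L : ι → Language α}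
    (hL : ∀ i ∈ S, IsStarFree (L i)) : IsStarFree ({w | ∃ i ∈ S, w ∈ L i} : Language α) := by
  induction S, hS using Set.Finite.induction_on with
  | empty =>
    refine zero.congr fun w => ?_
    change (∃ i ∈ (∅ : Set ι), w ∈ L i) ↔ _
    simp [Language.notMem_zero]
  | @insert i S _ _ ih =>
    refine ((hL i (by simp)).union _ _ (ih fun j hj => hL j (by simp [hj]))).congr fun w => ?_
    change (∃ j ∈ insert i S, w ∈ L j) ↔ w ∈ L i ∨ ∃ j ∈ S, w ∈ L j
    simp

theorem iUnion {ι : Type*} [Finite ι] {L : ι → Language α} (hL : ∀ i, IsStarFree (L i)) :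
    IsStarFree ({w | ∃ i, w ∈ L i} : Language α) := by
  refine (biUnion Set.finite_univ (fun i _ => hL i)).congr fun w => ?_
  change (∃ i, w ∈ L i) ↔ ∃ i ∈ Set.univ, w ∈ L i
  simp

/-- The words over a subalphabet form a star-free language. -/
theorem words [Finite α] (B : Set α) : IsStarFree ({w | ∀ x ∈ w, x ∈ B} : Language α) := by
  have h := (biUnion (Set.toFinite Bᶜ)
    (fun x _ => (top.concat _ _ (singleton [x])).concat _ _ (top (α := α)))).compl
  refine h.congr fun w => ?_
  change (∀ x ∈ w, x ∈ B) ↔ ¬ ∃ x ∈ Bᶜ, w ∈ (⊤ : Language α) * {[x]} * ⊤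
  have key : ∀ x, w ∈ (⊤ : Language α) * {[x]} * ⊤ ↔ x ∈ w := by
    intro x
    rw [List.mem_iff_append]
    constructor
    · rintro ⟨_, ⟨s, -, _, rfl, rfl⟩, t, -, rfl⟩
      exact ⟨s, t, by simp⟩
    · rintro ⟨s, t, rfl⟩
      exact ⟨s ++ [x], ⟨s, trivial, [x], rfl, rfl⟩, t, trivial, by simp⟩
  simp only [key]
  simp only [Set.mem_compl_iff]
  grind

end IsStarFree

/-! ### Local divisors of aperiodic monoids. -/

/-- The local divisor of a monoid at `c`: the set `M c ∩ c M` with the product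
`x c ∘ c y = x c y`, in which `c` is the neutral element. -/
def LocalDivisor {M : Type*} [Monoid M] (c : M) : Type _ :=
  {m : M // (∃ x, m = x * c) ∧ ∃ y, m = c * y}

namespace LocalDivisor

variable {M : Type*} [Monoid M] {c : M}

instance [Finite M] : Finite (LocalDivisor c) :=
  inferInstanceAs (Finite {m : M // (∃ x, m = x * c) ∧ ∃ y, m = c * y})

noncomputable instance : Mul (LocalDivisor c) where
  mul m m' := ⟨m.2.1.choose * m'.1, by
    obtain ⟨x, hx⟩ := m'.2.1
    exact ⟨m.2.1.choose * x, by rw [mul_assoc, ← hx]⟩, by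
    obtain ⟨y, hy⟩ := m'.2.2
    obtain ⟨z, hz⟩ := m.2.2
    exact ⟨z * y, by
      rw [← mul_assoc, ← hz, hy, ← mul_assoc, ← m.2.1.choose_spec]⟩⟩

/-- The product does not depend on the chosen left factor: if `m' = c y`, then `x m' = (x c) y = m
y`. -/
theorem mul_val {m m' : LocalDivisor c} {x : M} (hx : m.1 = x * c) : (m * m').1 = x * m'.1 := by
  obtain ⟨y, hy⟩ := m'.2.2
  change m.2.1.choose * m'.1 = _
  rw [hy, ← mul_assoc, ← mul_assoc, ← hx, ← m.2.1.choose_spec]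

instance : One (LocalDivisor c) where
  one := ⟨c, ⟨1, by simp⟩, ⟨1, by simp⟩⟩

theorem one_val : (1 : LocalDivisor c).1 = c := rfl

noncomputable instance : Monoid (LocalDivisor c) where
  mul_assoc m m' m'' := by
    obtain ⟨x, hx⟩ := m.2.1
    obtain ⟨x', hx'⟩ := m'.2.1
    have h : (m * m').1 = x * x' * c := by rw [mul_val hx, hx', mul_assoc]
    apply Subtype.ext
    rw [mul_val h, mul_val hx, mul_val hx', mul_assoc]
  one_mul m := by
    apply Subtype.ext
    rw [mul_val (x := 1) (by rw [one_val, one_mul]), one_mul]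
  mul_one m := by
    obtain ⟨x, hx⟩ := m.2.1
    apply Subtype.ext
    rw [mul_val hx, one_val, hx]

theorem pow_val {m : LocalDivisor c} {x : M} (hx : m.1 = x * c) (k : ℕ) :
    (m ^ k).1 = x ^ k * c := by
  induction k with
  | zero => rw [pow_zero, pow_zero, one_mul, one_val]
  | succ k ih => rw [pow_succ', mul_val hx, ih, pow_succ', mul_assoc]

theorem aperiodic (hM : ∀ x : M, ∃ k, x ^ (k + 1) = x ^ k) (m : LocalDivisor c) :
    ∃ k, m ^ (k + 1) = m ^ k := by
  obtain ⟨x, hx⟩ := m.2.1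
  obtain ⟨k, hk⟩ := hM x
  exact ⟨k, Subtype.ext (by rw [pow_val hx, pow_val hx, hk])⟩

/-- The element `1` is missing from the local divisor: if `1 = x c = c y`, then `c` is a unit, and
cancelling in `c ^ (k + 1) = c ^ k` gives `c = 1`. -/
theorem card_lt [Finite M] (hM : ∀ x : M, ∃ k, x ^ (k + 1) = x ^ k) (hc : c ≠ 1) :
    Nat.card (LocalDivisor c) < Nat.card M := by
  have : Fintype M := Fintype.ofFinite M
  have : Fintype (LocalDivisor c) := Fintype.ofFinite _
  rw [Nat.card_eq_fintype_card, Nat.card_eq_fintype_card]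
  refine Fintype.card_lt_of_injective_of_notMem (fun m : LocalDivisor c => m.1)
    Subtype.val_injective (b := 1) ?_
  rintro ⟨m, hm⟩
  obtain ⟨x, hx⟩ := m.2.1
  obtain ⟨y, hy⟩ := m.2.2
  change m.1 = 1 at hm
  have hu : IsUnit c := ⟨⟨c, x, by
    have : x = y := by
      rw [← mul_one x, ← hm, hy, ← mul_assoc, ← hx, hm, one_mul]
    rw [this, ← hy, hm], by rw [← hx, hm]⟩, rfl⟩
  obtain ⟨k, hk⟩ := hM c
  exact hc ((hu.pow k).mul_left_cancel (by rw [← pow_succ, hk, mul_one]))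

/-- Multiplication by `c` on both sides. -/
def sandwich (c : M) (m : M) : LocalDivisor c :=
  ⟨c * m * c, ⟨c * m, rfl⟩, ⟨m * c, mul_assoc _ _ _⟩⟩

end LocalDivisor

/-! ### Cutting words at the occurrences of a letter. -/

section Blocks

variable {α M : Type*} [Monoid M]

/-- The word obtained by closing each of the given blocks with the letter `c`. -/
def closeBlocks (c : α) (us : List (List α)) : List α := (us.map (· ++ [c])).flatten

@[simp] theorem closeBlocks_nil (c : α) : closeBlocks c [] = [] := rfl

@[simp] theorem closeBlocks_cons (c : α) (u : List α) (us : List (List α)) :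
    closeBlocks c (u :: us) = u ++ c :: closeBlocks c us := by simp [closeBlocks]

@[simp] theorem closeBlocks_append (c : α) (us vs : List (List α)) :
    closeBlocks c (us ++ vs) = closeBlocks c us ++ closeBlocks c vs := by simp [closeBlocks]

/-- The value of a word under the extension of a map of letters to a monoid. -/
def wordValue (h : α → M) (w : List α) : M := (w.map h).prod

@[simp] theorem wordValue_nil (h : α → M) : wordValue h [] = 1 := rfl

@[simp] theorem wordValue_cons (h : α → M) (x : α) (w : List α) :
    wordValue h (x :: w) = h x * wordValue h w := by simp [wordValue]

@[simp] theorem wordValue_append (h : α → M) (v w : List α) :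
    wordValue h (v ++ w) = wordValue h v * wordValue h w := by simp [wordValue]

open Classical in
/-- The values of the blocks of a word that are closed by the letter `c`, where the value of the
first block is multiplied by `m`. -/
noncomputable def blockValues (h : α → M) (c : α) : M → List α → List M
  | _, [] => []
  | m, x :: w => if x = c then m :: blockValues h c 1 w else blockValues h c (m * h x) w

theorem blockValues_append_cons (h : α → M) (c : α) {u : List α} (hu : c ∉ u) (w : List α) (m : M) :
    blockValues h c m (u ++ c :: w) = (m * wordValue h u) :: blockValues h c 1 w := by
  induction u generalizing m with
  | nil => simp [blockValues]
  | cons x u ih =>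
    rw [List.mem_cons, not_or] at hu
    simp [blockValues, Ne.symm hu.1, ih hu.2, mul_assoc]

theorem blockValues_closeBlocks (h : α → M) (c : α) {us : List (List α)} (hus : ∀ u ∈ us, c ∉ u) :
    blockValues h c 1 (closeBlocks c us) = us.map (wordValue h) := by
  induction us with
  | nil => simp [blockValues]
  | cons u us ih =>
    rw [closeBlocks_cons, blockValues_append_cons h c (hus u (by simp)),
      ih fun v hv => hus v (by simp [hv])]
    simp

theorem exists_closeBlocks (c : α) (w : List α) :
    ∃ us u, w = closeBlocks c us ++ u ∧ (∀ v ∈ us, c ∉ v) ∧ c ∉ u := by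
  induction w with
  | nil => exact ⟨[], [], by simp⟩
  | cons x w ih =>
    obtain ⟨us, u, rfl, hus, hu⟩ := ih
    by_cases hx : x = c
    · exact ⟨[] :: us, u, by simp [hx], by simpa using hus, hu⟩
    · cases us with
      | nil => exact ⟨[], x :: u, by simp, by simp, by simp [Ne.symm hx, hu]⟩
      | cons v us =>
        refine ⟨(x :: v) :: us, u, by simp, ?_, hu⟩
        simp only [List.mem_cons, forall_eq_or_imp] at hus ⊢
        exact ⟨by simp [Ne.symm hx, hus.1], hus.2⟩

theorem mem_of_mem_closeBlocks {c : α} {us : List (List α)} {u : List α} (hu : u ∈ us) {x : α}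
    (hx : x ∈ u) : x ∈ closeBlocks c us := by
  simp only [closeBlocks, List.mem_flatten, List.mem_map]
  exact ⟨u ++ [c], ⟨u, hu, rfl⟩, by simp [hx]⟩

theorem mem_closeBlocks_imp {c : α} {us : List (List α)} {x : α} (hx : x ∈ closeBlocks c us) :
    x = c ∨ ∃ u ∈ us, x ∈ u := by
  simp only [closeBlocks, List.mem_flatten, List.mem_map] at hx
  obtain ⟨_, ⟨u, hu, rfl⟩, hx⟩ := hx
  simp only [List.mem_append, List.mem_singleton] at hx
  exact hx.symm.imp id fun hx => ⟨u, hu, hx⟩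

/-- This is where the local divisor enters: its product absorbs the `h c` shared by neighbouring
factors `h c * m * h c`, so one evaluation there yields the value of a whole sequence of closed
blocks preceded by `c`. -/
theorem mul_wordValue_closeBlocks (h : α → M) (c : α) (us : List (List α)) :
    h c * wordValue h (closeBlocks c us) =
      (wordValue (LocalDivisor.sandwich (h c)) (us.map (wordValue h))).1 := by
  induction us with
  | nil => simp [LocalDivisor.one_val]
  | cons u us ih =>
    rw [List.map_cons, wordValue_cons,
      LocalDivisor.mul_val (x := h c * wordValue h u) rfl, ← ih]
    simp [mul_assoc]

/-- The words that consist of blocks over `B`, each closed by `c`, such that the values of the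
blocks form a word in `K`. -/
def blockPullback (h : α → M) (c : α) (B : Set α) (K : Language M) : Language α :=
  {w | ∃ us : List (List α), (∀ u ∈ us, ∀ x ∈ u, x ∈ B) ∧ us.map (wordValue h) ∈ K ∧
    w = closeBlocks c us}

/-- The words over `B` that have the value `m`. -/
def valueLanguage (h : α → M) (B : Set α) (m : M) : Language α :=
  {w | (∀ x ∈ w, x ∈ B) ∧ wordValue h w = m}

theorem blockPullback_mul (h : α → M) (c : α) (B : Set α) (K L : Language M) :
    blockPullback h c B (K * L) = blockPullback h c B K * blockPullback h c B L := by
  ext w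
  constructor
  · rintro ⟨us, hus, ⟨k, hk, l, hl, hkl⟩, rfl⟩
    obtain ⟨vs, ws, rfl, rfl, rfl⟩ := List.map_eq_append_iff.1 hkl.symm
    exact ⟨_, ⟨vs, fun u hu => hus u (by simp [hu]), hk, rfl⟩, _,
      ⟨ws, fun u hu => hus u (by simp [hu]), hl, rfl⟩, by simp⟩
  · rintro ⟨_, ⟨vs, hvs, hk, rfl⟩, _, ⟨ws, hws, hl, rfl⟩, rfl⟩
    refine ⟨vs ++ ws, fun u hu => ?_, ⟨_, hk, _, hl, by simp⟩, by simp⟩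
    exact (List.mem_append.1 hu).elim (hvs u) (hws u)

theorem blockPullback_singleton_cons (h : α → M) (c : α) (B : Set α) (m : M) (v : List M) :
    blockPullback h c B {m :: v} =
      valueLanguage h B m * {[c]} * blockPullback h c B {v} := by
  ext w
  constructor
  · rintro ⟨us, hus, hm, rfl⟩
    obtain ⟨u, us, rfl, rfl, rfl⟩ := List.map_eq_cons_iff.1
      (show us.map (wordValue h) = m :: v from hm)
    exact ⟨u ++ [c], ⟨u, ⟨hus u (by simp), rfl⟩, [c], rfl, rfl⟩, _,
      ⟨us, fun u hu => hus u (by simp [hu]), rfl, rfl⟩, by simp⟩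
  · rintro ⟨_, ⟨u, ⟨hu, rfl⟩, _, rfl, rfl⟩, _, ⟨us, hus, hv, rfl⟩, rfl⟩
    have hv : us.map (wordValue h) = v := hv
    refine ⟨u :: us, by simpa using ⟨hu, hus⟩, ?_, by simp⟩
    change (u :: us).map (wordValue h) = _
    rw [List.map_cons, hv]

/-- Such words are exactly the words over `insert c B` that are empty or end in `c`. -/
theorem isStarFree_blockPullback_top [Finite α] (h : α → M) {c : α} {B : Set α} (hc : c ∉ B) :
    IsStarFree (blockPullback h c B ⊤) := by
  refine ((IsStarFree.words (insert c B)).inf ((IsStarFree.singleton []).union _ _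
    (IsStarFree.top.concat _ _ (IsStarFree.singleton [c])))).congr fun w => ?_
  change _ ↔ (∀ x ∈ w, x ∈ insert c B) ∧ (w = [] ∨ w ∈ (⊤ : Language α) * {[c]})
  constructor
  · rintro ⟨us, hus, -, rfl⟩
    refine ⟨fun x hx => (mem_closeBlocks_imp hx).imp id fun ⟨u, hu, hx⟩ => hus u hu x hx, ?_⟩
    rcases List.eq_nil_or_concat us with rfl | ⟨us, u, rfl⟩
    · exact Or.inl rfl
    · exact Or.inr ⟨closeBlocks c us ++ u, trivial, [c], rfl, by simp⟩
  · rintro ⟨hw, rfl | ⟨v, -, _, rfl, rfl⟩⟩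
    · exact ⟨[], by simp, trivial, rfl⟩
    · obtain ⟨us, u, rfl, hus, hu⟩ := exists_closeBlocks c v
      refine ⟨us ++ [u], fun v hv x hx => ?_, trivial, by simp⟩
      have hxc : x ≠ c := by
        rintro rfl
        rcases List.mem_append.1 hv with hv | hv
        · exact hus v hv hx
        · exact hu (List.mem_singleton.1 hv ▸ hx)
      refine (hw x ?_).resolve_left hxc
      rcases List.mem_append.1 hv with hv | hv
      · simp [mem_of_mem_closeBlocks hv hx]
      · simp [List.mem_singleton.1 hv ▸ hx]

/-- Since `c ∉ B`, the cutting into blocks is unique and `blockValues` recovers the block values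
from the word; no word can therefore lie in the pullbacks of both `K` and `Kᶜ`. -/
theorem blockPullback_compl (h : α → M) {c : α} {B : Set α} (hc : c ∉ B) (K : Language M)
    (w : List α) :
    w ∈ blockPullback h c B Kᶜ ↔ w ∈ blockPullback h c B ⊤ ∧ w ∉ blockPullback h c B K := by
  have hB : ∀ us : List (List α), (∀ u ∈ us, ∀ x ∈ u, x ∈ B) →
      us.map (wordValue h) = blockValues h c 1 (closeBlocks c us) := fun us hus =>
    (blockValues_closeBlocks h c fun u hu hcu => hc (hus u hu c hcu)).symm
  constructor
  · rintro ⟨us, hus, hK, rfl⟩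
    refine ⟨⟨us, hus, trivial, rfl⟩, ?_⟩
    rintro ⟨vs, hvs, hK', h'⟩
    rw [hB vs hvs, ← h', ← hB us hus] at hK'
    exact hK hK'
  · rintro ⟨⟨us, hus, -, rfl⟩, hK⟩
    exact ⟨us, hus, fun h' => hK ⟨us, hus, h', rfl⟩, rfl⟩

theorem isStarFree_blockPullback [Finite α] (h : α → M) {c : α} {B : Set α} (hc : c ∉ B)
    (hB : ∀ m, IsStarFree (valueLanguage h B m)) {K : Language M} (hK : IsStarFree K) :
    IsStarFree (blockPullback h c B K) := by
  induction hK with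
  | finite K hK =>
    have hs : ∀ v : List M, IsStarFree (blockPullback h c B {v}) := by
      intro v
      induction v with
      | nil =>
        refine (IsStarFree.singleton []).congr fun w => ?_
        constructor
        · rintro ⟨us, -, hus, rfl⟩
          rw [List.map_eq_nil_iff.1 (show us.map (wordValue h) = [] from hus)]
          rfl
        · intro hw
          exact ⟨[], by simp, rfl, hw⟩
      | cons m v ih =>
        rw [blockPullback_singleton_cons]
        exact ((hB m).concat _ _ (IsStarFree.singleton [c])).concat _ _ ih
    refine (IsStarFree.biUnion hK fun v _ => hs v).congr fun w => ?_
    constructor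
    · rintro ⟨us, hus, hu, rfl⟩
      exact ⟨_, hu, us, hus, rfl, rfl⟩
    · rintro ⟨v, hv, us, hus, hu, rfl⟩
      exact ⟨us, hus, (show us.map (wordValue h) = v from hu) ▸ hv, rfl⟩
  | union K L _ _ hK hL =>
    refine (hK.union _ _ hL).congr fun w => ?_
    constructor
    · rintro ⟨us, hus, hu | hu, rfl⟩
      · exact Or.inl ⟨us, hus, hu, rfl⟩
      · exact Or.inr ⟨us, hus, hu, rfl⟩
    · rintro (⟨us, hus, hu, rfl⟩ | ⟨us, hus, hu, rfl⟩)
      · exact ⟨us, hus, Or.inl hu, rfl⟩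
      · exact ⟨us, hus, Or.inr hu, rfl⟩
  | compl K _ hK =>
    exact ((isStarFree_blockPullback_top h hc).inf hK.compl).congr (blockPullback_compl h hc K)
  | concat K L _ _ hK hL =>
    rw [blockPullback_mul]
    exact hK.concat _ _ hL

/-- A word in which `c` occurs is cut at its first and its last `c`. The middle piece is a sequence
of closed blocks, whose value together with the first `c` is an element of the local divisor. -/
theorem mem_valueLanguage_insert (h : α → M) {c : α} {B : Set α} (m : M)
    (w : List α) :
    w ∈ valueLanguage h (insert c B) m ↔ w ∈ valueLanguage h B m ∨
      ∃ p : M × LocalDivisor (h c) × M, w ∈ ({w | p.1 * p.2.1.1 * p.2.2 = m ∧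
        w ∈ valueLanguage h B p.1 * {[c]} *
          blockPullback h c B (valueLanguage (LocalDivisor.sandwich (h c)) Set.univ p.2.1) *
          valueLanguage h B p.2.2} : Language α) := by
  constructor
  · rintro ⟨hw, rfl⟩
    obtain ⟨us, u, rfl, hus, hu⟩ := exists_closeBlocks c w
    have hu' : ∀ x ∈ u, x ∈ B := fun x hx =>
      (hw x (by simp [hx])).resolve_left fun h => hu (h ▸ hx)
    have hus' : ∀ v ∈ us, ∀ x ∈ v, x ∈ B := fun v hv x hx =>
      (hw x (by simp [mem_of_mem_closeBlocks hv hx])).resolve_left fun h => hus v hv (h ▸ hx)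
    cases us with
    | nil => exact Or.inl ⟨by simpa using hu', by simp⟩
    | cons v us =>
      refine Or.inr ⟨(wordValue h v,
        wordValue (LocalDivisor.sandwich (h c)) (us.map (wordValue h)), wordValue h u), ?_, ?_⟩
      · simp [← mul_wordValue_closeBlocks, mul_assoc]
      · refine ⟨v ++ [c] ++ closeBlocks c us, ⟨v ++ [c],
          ⟨v, ⟨hus' v (by simp), rfl⟩, [c], rfl, rfl⟩,
          _, ⟨us, fun u hu => hus' u (by simp [hu]), ⟨by simp, rfl⟩, rfl⟩, rfl⟩, u, ⟨hu', rfl⟩,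
          by simp⟩
  · rintro (⟨hw, rfl⟩ | ⟨⟨m₁, m₂, m₃⟩, hm, _, ⟨_, ⟨v, ⟨hv, rfl⟩, _, rfl, rfl⟩, _,
      ⟨us, hus, ⟨-, rfl⟩, rfl⟩, rfl⟩, u, ⟨hu, rfl⟩, rfl⟩)
    · exact ⟨fun x hx => Or.inr (hw x hx), rfl⟩
    · refine ⟨fun x hx => ?_, ?_⟩
      · simp only [List.mem_append, List.mem_singleton] at hx
        rcases hx with ((hx | hx) | hx) | hx
        · exact Or.inr (hv x hx)
        · exact Or.inl hx
        · exact (mem_closeBlocks_imp hx).imp id fun ⟨u, hu, hx⟩ => hus u hu x hx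
        · exact Or.inr (hu x hx)
      · rw [← hm]
        simp [← mul_wordValue_closeBlocks, mul_assoc]

end Blocks

/-- The languages recognized by a finite aperiodic monoid are star-free. -/
theorem isStarFree_valueLanguage {M : Type u} [Monoid M] [Finite M]
    (hM : ∀ x : M, ∃ k, x ^ (k + 1) = x ^ k) {α : Type u} [Finite α] (h : α → M) (B : Set α)
    (m : M) : IsStarFree (valueLanguage h B m) := by
  -- The alphabet is generalized because the inductive call has `M` itself as alphabet and the local
  -- divisor as monoid; hence also the common universe of `M` and `α`. The inner induction removes
  -- letters from `B`.
  induction hn : Nat.card M using Nat.strong_induction_on generalizing M α with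
  | _ n ih =>
  subst hn
  induction hk : B.ncard using Nat.strong_induction_on generalizing B m with
  | _ k ihB =>
  subst hk
  by_cases hB : ∀ x ∈ B, h x = 1
  · have hv : ∀ w : List α, (∀ x ∈ w, x ∈ B) → wordValue h w = 1 := fun w hw =>
      List.prod_eq_one (by simpa using fun x hx => hB x (hw x hx))
    by_cases hm : m = 1
    · refine (IsStarFree.words B).congr fun w => ?_
      exact ⟨fun hw => hw.1, fun hw => ⟨hw, hm ▸ hv w hw⟩⟩
    · refine IsStarFree.zero.congr fun w => ?_
      exact ⟨fun hw => (hm (hw.2.symm.trans (hv w hw.1))).elim, fun hw => hw.elim⟩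
  · push Not at hB
    obtain ⟨c, hcB, hc⟩ := hB
    have hc' : c ∉ B \ {c} := by simp
    have hlt : (B \ {c}).ncard < B.ncard := Set.ncard_sdiff_singleton_lt_of_mem hcB
    have hS := fun m => ihB _ hlt _ m rfl
    rw [← Set.insert_sdiff_self_of_mem hcB]
    refine ((hS m).union _ _ (IsStarFree.iUnion ?_)).congr (mem_valueLanguage_insert h m)
    rintro ⟨m₁, m₂, m₃⟩
    by_cases hm : m₁ * m₂.1 * m₃ = m
    · refine ((((hS m₁).concat _ _ (IsStarFree.singleton [c])).concat _ _
        (isStarFree_blockPullback h hc' hS ?_)).concat _ _ (hS m₃)).congr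
        fun w => ⟨fun hw => hw.2, fun hw => ⟨hm, hw⟩⟩
      exact ih _ (LocalDivisor.card_lt hM hc) (LocalDivisor.aperiodic hM) _ _ _ rfl
    · exact IsStarFree.zero.congr fun w => ⟨fun hw => (hm hw.1).elim, fun hw => hw.elim⟩

/-! ### From aperiodic automata to star-free languages. -/

section Aperiodic

theorem Function.End.pow_eq_iterate {σ : Type*} (f : σ → σ) (k : ℕ) :
    (show Function.End σ from f) ^ k = f^[k] := by
  induction k with
  | zero => rfl
  | succ k ih =>
    exact (pow_succ (show Function.End σ from f) k).trans
      (congrArg (fun g : Function.End σ => g * (show Function.End σ from f)) ih)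

/-- Two iterates `f^[i]` and `f^[j]` with `i < j` coincide, so `f` permutes the range of `f^[i]`. By
aperiodicity it is the identity there. -/
theorem IsAperiodicDFA.exists_iterate_succ_eq {α σ : Type*} [Finite σ] {M : DFA α σ}
    (hM : IsAperiodicDFA M) (w : List α) :
    ∃ k, (fun q => M.evalFrom q w)^[k + 1] = (fun q => M.evalFrom q w)^[k] := by
  set f : σ → σ := fun q => M.evalFrom q w with hf
  obtain ⟨i, j, hij, h⟩ := Finite.exists_ne_map_eq_of_infinite (fun k : ℕ => f^[k])
  wlog hlt : i < j generalizing i j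
  · exact this j i hij.symm h.symm (by omega)
  obtain ⟨p, rfl⟩ := Nat.exists_eq_add_of_lt hlt
  have hp : ∀ q ∈ Set.range f^[i], f^[p] (f q) = q := by
    rintro _ ⟨q, rfl⟩
    rw [← Function.iterate_succ_apply, ← Function.iterate_add_apply]
    have : f^[i] q = f^[i + p + 1] q := congrFun h q
    rw [this, show i + p + 1 = p.succ + i by omega]
  have hmaps : Set.MapsTo f (Set.range f^[i]) (Set.range f^[i]) := by
    rintro _ ⟨q, rfl⟩
    exact ⟨f q, by rw [← Function.iterate_succ_apply, Function.iterate_succ_apply']⟩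
  have hbij : Set.BijOn f (Set.range f^[i]) (Set.range f^[i]) := by
    refine ⟨hmaps, fun a ha b hb hab => by rw [← hp a ha, ← hp b hb, hab], fun a ha => ?_⟩
    refine ⟨f^[p] a, hmaps.iterate p ha, ?_⟩
    exact (Function.iterate_succ_apply' f p a).symm.trans
      ((Function.iterate_succ_apply f p a).trans (hp a ha))
  refine ⟨i, funext fun q => ?_⟩
  refine (Function.iterate_succ_apply' f i q).trans ?_
  exact hM w _ hbij _ ⟨q, rfl⟩

/-- **Schützenberger's theorem**, for automata: a finite aperiodic automaton accepts a star-free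
language. -/
theorem IsAperiodicDFA.isStarFree_accepts {α σ : Type u} [Finite α] [Finite σ] {M : DFA α σ}
    (hM : IsAperiodicDFA M) : IsStarFree M.accepts := by
  -- Words act from left to right while endomaps compose from right to left, hence the opposite
  -- monoid.
  let φ : List α → (Function.End σ)ᵐᵒᵖ := fun w => MulOpposite.op fun q => M.evalFrom q w
  have hφ : ∀ v w, φ (v ++ w) = φ v * φ w := fun v w =>
    MulOpposite.unop_injective (funext fun q => M.evalFrom_of_append q v w)
  let N : Submonoid (Function.End σ)ᵐᵒᵖ :=
    { carrier := Set.range φ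
      one_mem' := ⟨[], rfl⟩
      mul_mem' := by
        rintro _ _ ⟨v, rfl⟩ ⟨w, rfl⟩
        exact ⟨v ++ w, hφ v w⟩ }
  have : Finite (Function.End σ)ᵐᵒᵖ := .of_equiv (σ → σ) MulOpposite.opEquiv
  have hN : ∀ x : N, ∃ k, x ^ (k + 1) = x ^ k := by
    rintro ⟨_, w, rfl⟩
    obtain ⟨k, hk⟩ := hM.exists_iterate_succ_eq w
    refine ⟨k, Subtype.ext (MulOpposite.unop_injective ?_)⟩
    rw [SubmonoidClass.coe_pow, SubmonoidClass.coe_pow, MulOpposite.unop_pow,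
      MulOpposite.unop_pow]
    exact (Function.End.pow_eq_iterate _ _).trans (hk.trans (Function.End.pow_eq_iterate _ _).symm)
  let h : α → N := fun x => ⟨φ [x], [x], rfl⟩
  have hw : ∀ w, (wordValue h w).1 = φ w := by
    intro w
    induction w with
    | nil => rfl
    | cons x w ih =>
      rw [wordValue_cons, Submonoid.coe_mul, ih]
      exact (hφ [x] w).symm
  refine (IsStarFree.biUnion (Set.toFinite {m : N | m.1.unop M.start ∈ M.accept}) fun m _ =>
    isStarFree_valueLanguage hN h Set.univ m).congr fun w => ?_
  constructor
  · intro hmem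
    exact ⟨wordValue h w, by rw [Set.mem_ofPred_eq, hw]; exact hmem, by simp, rfl⟩
  · rintro ⟨_, hm, -, rfl⟩
    rw [Set.mem_ofPred_eq, hw] at hm
    exact hm

/-- An automaton with monotone transitions is aperiodic. -/
theorem IsAperiodicDFA.of_monotone {α σ : Type*} [LinearOrder σ] [WellFoundedLT σ] {M : DFA α σ}
    (hM : ∀ x, Monotone fun q => M.step q x) : IsAperiodicDFA M := by
  intro w S hS
  have hw : Monotone fun q => M.evalFrom q w := by
    clear hS
    induction w with
    | nil => exact monotone_id
    | cons x w ih => exact ih.comp (hM x)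
  intro q
  induction q using WellFoundedLT.induction with
  | _ q ih =>
  intro hq
  -- Strong induction: a preimage `p < q` would be fixed and so equal to `q`. If `p > q`,
  -- monotonicity puts the image of `q` at or below `q`; an image strictly below is itself fixed,
  -- which contradicts injectivity.
  obtain ⟨p, hp, hpq⟩ := hS.surjOn hq
  rcases lt_trichotomy p q with hlt | rfl | hlt
  · exact absurd ((ih p hlt hp).symm.trans hpq) hlt.ne
  · exact hpq
  · have hle : M.evalFrom q w ≤ q := (hw hlt.le).trans_eq hpq
    rcases hle.lt_or_eq with hlt' | heq
    · exact hS.injOn (hS.mapsTo hq) hq (ih _ hlt' (hS.mapsTo hq))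
    · exact heq

end Aperiodic

/-! ### The subset automaton for the iteration. -/

namespace DFA

variable {α σ : Type*} (M : DFA α σ)

/-- The subset automaton for the iteration of the language of `M`: whenever an accepting state is
reached, the initial state is added. It accepts the iteration up to the empty word. -/
def iterSubset : DFA α (Set σ) where
  step T x := {q | (∃ p ∈ T, M.step p x = q) ∨ q = M.start ∧ ∃ p ∈ T, M.step p x ∈ M.accept}
  start := {M.start}
  accept := {T | ∃ q ∈ T, q ∈ M.accept}

theorem mem_iterSubset_step {T : Set σ} {x : α} {q : σ} :
    q ∈ M.iterSubset.step T x ↔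
      (∃ p ∈ T, M.step p x = q) ∨ q = M.start ∧ ∃ p ∈ T, M.step p x ∈ M.accept := Iff.rfl

theorem _root_.Language.exists_append_of_mem_kstar {L : Language α} {w : List α} (hw : w ∈ L∗) (hne : w ≠ []) :
    ∃ u v, w = u ++ v ∧ u ∈ L∗ ∧ v ∈ L ∧ v ≠ [] := by
  obtain ⟨S, rfl, hS⟩ := Language.mem_kstar_iff_exists_nonempty.1 hw
  rcases List.eq_nil_or_concat S with rfl | ⟨S, v, rfl⟩
  · exact absurd rfl hne
  · refine ⟨S.flatten, v, by simp, Language.join_mem_kstar fun y hy => (hS y (by simp [hy])).1, ?_⟩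
    exact hS v (by simp)

theorem _root_.Language.append_mem_kstar {L : Language α} {u v : List α} (hu : u ∈ L∗) (hv : v ∈ L) :
    u ++ v ∈ L∗ := by
  obtain ⟨S, rfl, hS⟩ := Language.mem_kstar.1 hu
  refine Language.mem_kstar.2 ⟨S ++ [v], by simp, fun y hy => ?_⟩
  rcases List.mem_append.1 hy with hy | hy
  · exact hS y hy
  · rwa [List.mem_singleton.1 hy]

theorem mem_iterSubset_eval {w : List α} {q : σ} :
    q ∈ M.iterSubset.eval w ↔ ∃ u v, w = u ++ v ∧ u ∈ M.accepts∗ ∧ M.eval v = q := by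
  induction w using List.reverseRecOn generalizing q with
  | nil =>
    simp only [eval_nil, List.nil_eq, List.append_eq_nil_iff]
    constructor
    · intro h
      exact ⟨[], [], ⟨rfl, rfl⟩, Language.nil_mem_kstar _, (Set.mem_singleton_iff.1 h).symm⟩
    · rintro ⟨_, _, ⟨rfl, rfl⟩, -, rfl⟩
      exact rfl
  | append_singleton w x ih =>
    rw [eval_append_singleton, mem_iterSubset_step]
    simp only [ih]
    constructor
    · rintro (⟨_, ⟨u, v, rfl, hu, rfl⟩, rfl⟩ | ⟨rfl, _, ⟨u, v, rfl, hu, rfl⟩, h⟩)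
      · exact ⟨u, v ++ [x], by simp, hu, by simp⟩
      · refine ⟨u ++ v ++ [x], [], by simp, ?_, rfl⟩
        rw [List.append_assoc]
        exact Language.append_mem_kstar hu (by rwa [mem_accepts, eval_append_singleton])
    · rintro ⟨u, v, h, hu, rfl⟩
      rcases List.eq_nil_or_concat v with rfl | ⟨v, y, rfl⟩
      · rw [List.append_nil] at h
        subst h
        -- Here the whole word lies in the iteration. Its last nonempty factor ends with the letter
        -- just read, so an accepting state is being hit.
        obtain ⟨u, v, h, hu', hv, hne⟩ := Language.exists_append_of_mem_kstar hu (by simp)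
        obtain ⟨v, y, rfl⟩ := (List.eq_nil_or_concat v).resolve_left hne
        rw [List.concat_eq_append, ← List.append_assoc] at h
        obtain ⟨rfl, h⟩ := List.append_inj' h rfl
        obtain rfl : x = y := by simpa using h
        refine Or.inr ⟨rfl, _, ⟨u, v, rfl, hu', rfl⟩, ?_⟩
        rwa [List.concat_eq_append, mem_accepts, eval_append_singleton] at hv
      · rw [List.concat_eq_append, ← List.append_assoc] at h
        obtain ⟨rfl, h⟩ := List.append_inj' h rfl
        obtain rfl : x = y := by simpa using h
        exact Or.inl ⟨_, ⟨u, v, rfl, hu, rfl⟩, by simp⟩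

/-- The empty word is excluded because `{M.start}` need not be accepting; this exception is the
source of the extra quotient in the count. -/
theorem mem_kstar_iff {w : List α} (hw : w ≠ []) :
    w ∈ M.accepts∗ ↔ M.iterSubset.eval w ∈ M.iterSubset.accept := by
  constructor
  · intro h
    obtain ⟨u, v, rfl, hu, hv, -⟩ := Language.exists_append_of_mem_kstar h hw
    exact ⟨_, M.mem_iterSubset_eval.2 ⟨u, v, rfl, hu, rfl⟩, hv⟩
  · rintro ⟨q, hq, hacc⟩
    obtain ⟨u, v, rfl, hu, rfl⟩ := M.mem_iterSubset_eval.1 hq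
    exact Language.append_mem_kstar hu hacc

theorem leftQuotient_kstar {w : List α} (hw : w ≠ []) :
    (M.accepts∗).leftQuotient w = M.iterSubset.acceptsFrom (M.iterSubset.eval w) := by
  ext x
  rw [Language.mem_leftQuotient, mem_kstar_iff _ (by simp [hw]), mem_acceptsFrom, eval,
    evalFrom_of_append]

theorem nonempty_iterSubset_eval (w : List α) : (M.iterSubset.eval w).Nonempty :=
  ⟨M.eval w, M.mem_iterSubset_eval.2 ⟨[], w, rfl, Language.nil_mem_kstar _, rfl⟩⟩

theorem start_mem_iterSubset_eval {w : List α} {f : σ} (hf : f ∈ M.accept)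
    (h : f ∈ M.iterSubset.eval w) : M.start ∈ M.iterSubset.eval w := by
  obtain ⟨u, v, rfl, hu, rfl⟩ := M.mem_iterSubset_eval.1 h
  exact M.mem_iterSubset_eval.2 ⟨u ++ v, [], by simp, Language.append_mem_kstar hu hf, rfl⟩

end DFA

/-! ### Counting subsets, and the upper bound. -/

/-- The nonempty sets that contain `s` if they contain `f`. -/
def guardedSets {σ : Type*} (f s : σ) : Set (Set σ) := {T | T.Nonempty ∧ (f ∈ T → s ∈ T)}

theorem encard_guardedSets {σ : Type*} [Finite σ] {f s : σ} (hfs : f ≠ s) :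
    (guardedSets f s).encard + 1 =
      ((2 ^ (Nat.card σ - 1) + 2 ^ (Nat.card σ - 2) : ℕ) : ℕ∞) := by
  classical
  have : Fintype σ := Fintype.ofFinite σ
  let A : Finset (Finset σ) := Finset.univ.filter fun T => T.Nonempty ∧ (f ∈ T → s ∈ T)
  have hA : guardedSets f s = (fun T : Finset σ => (T : Set σ)) '' A := by
    ext T
    constructor
    · intro hT
      exact ⟨T.toFinset, by simpa [A, guardedSets] using hT, by simp⟩
    · rintro ⟨T, hT, rfl⟩
      simpa [A, guardedSets] using hT
  -- The excluded sets are the empty one and those with `f` but without `s`. The latter form an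
  -- interval of `2 ^ (Nat.card σ - 2)` sets.
  have hB : (Finset.univ.filter fun T : Finset σ => ¬ (T.Nonempty ∧ (f ∈ T → s ∈ T))) =
      insert ∅ (Finset.Icc {f} {s}ᶜ) := by
    ext T
    simp only [Finset.mem_filter, Finset.mem_univ, true_and, Finset.mem_insert, Finset.mem_Icc,
      Finset.singleton_subset_iff, Finset.subset_compl_singleton,
      not_and_or, Finset.not_nonempty_iff_eq_empty, Classical.not_imp]
  have hle : ({f} : Finset σ) ⊆ {s}ᶜ := by simpa using hfs.symm
  have hcard := Finset.card_filter_add_card_filter_not (s := (Finset.univ : Finset (Finset σ)))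
    (fun T => T.Nonempty ∧ (f ∈ T → s ∈ T))
  rw [hB, Finset.card_insert_of_notMem (by simp), Finset.card_Icc_finset hle, Finset.card_univ,
    Fintype.card_finset, Finset.card_compl, Finset.card_singleton, Finset.card_singleton] at hcard
  have h2 : 2 ≤ Fintype.card σ := by
    have := Fintype.one_lt_card_iff.2 ⟨f, s, hfs⟩
    omega
  rw [hA, Set.InjOn.encard_image Finset.coe_injective.injOn, Set.encard_coe_eq_coe_finsetCard,
    Nat.card_eq_fintype_card]
  norm_cast
  change A.card + _ = _ at hcard
  obtain ⟨k, hk⟩ := Nat.exists_eq_add_of_le h2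
  rw [hk] at hcard ⊢
  rw [show 2 + k - 1 - 1 = k by omega, show 2 + k = k + 1 + 1 by omega, pow_succ, pow_succ] at hcard
  rw [show 2 + k - 1 = k + 1 by omega, show 2 + k - 2 = k by omega, pow_succ]
  omega

theorem quotientComplexity_zero {α : Type*} : quotientComplexity (0 : Language α) = 1 := by
  have h : Set.range (0 : Language α).leftQuotient = {0} := by
    ext K
    simp only [Set.mem_range, Set.mem_singleton_iff]
    have hq : ∀ w, (0 : Language α).leftQuotient w = 0 := fun w => rfl
    simp [hq, eq_comm]
  rw [quotientComplexity, h, Set.encard_singleton]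

theorem DFA.quotientComplexity_kstar_le {α σ : Type*} [Finite σ] (M : DFA α σ) {f : σ}
    (hf : f ∈ M.accept) (hfs : f ≠ M.start) :
    quotientComplexity (M.accepts∗) ≤
      ((2 ^ (Nat.card σ - 1) + 2 ^ (Nat.card σ - 2) : ℕ) : ℕ∞) := by
  rw [← encard_guardedSets hfs]
  have hsub : Set.range (M.accepts∗).leftQuotient ⊆
      insert (M.accepts∗) (M.iterSubset.acceptsFrom '' guardedSets f M.start) := by
    rintro _ ⟨w, rfl⟩
    by_cases hw : w = []
    · exact Or.inl (by rw [hw, Language.leftQuotient_nil])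
    · exact Or.inr ⟨_, ⟨M.nonempty_iterSubset_eval w, M.start_mem_iterSubset_eval hf⟩,
        (M.leftQuotient_kstar hw).symm⟩
  calc _ ≤ _ := Set.encard_le_encard hsub
    _ ≤ _ := Set.encard_insert_le _ _
    _ ≤ _ := by gcongr; exact Set.encard_image_le _ _

theorem DFA.quotientComplexity_kstar_eq {α σ : Type*} [Finite σ] (M : DFA α σ) {f : σ}
    (hf : f ∈ M.accept) (hfs : f ≠ M.start)
    (hreach : ∀ T ∈ guardedSets f M.start, ∃ w, w ≠ [] ∧ M.iterSubset.eval w = T)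
    (hinj : Set.InjOn M.iterSubset.acceptsFrom (guardedSets f M.start))
    (hne : ∀ T ∈ guardedSets f M.start, M.iterSubset.acceptsFrom T ≠ M.accepts∗) :
    quotientComplexity (M.accepts∗) =
      ((2 ^ (Nat.card σ - 1) + 2 ^ (Nat.card σ - 2) : ℕ) : ℕ∞) := by
  refine le_antisymm (M.quotientComplexity_kstar_le hf hfs) ?_
  rw [← encard_guardedSets hfs, ← hinj.encard_image, ← Set.encard_insert_of_notMem
    (a := M.accepts∗) (by rintro ⟨T, hT, h⟩; exact hne T hT h)]
  refine Set.encard_le_encard ?_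
  rintro _ (rfl | ⟨T, hT, rfl⟩)
  · exact ⟨[], rfl⟩
  · obtain ⟨w, hw, rfl⟩ := hreach T hT
    exact ⟨w, M.leftQuotient_kstar hw⟩

theorem DFA.quotientComplexity_eq {α σ : Type*} (M : DFA α σ)
    (hreach : Function.Surjective M.eval) (hinj : Function.Injective M.acceptsFrom) :
    quotientComplexity M.accepts = ENat.card σ := by
  rw [quotientComplexity, Language.leftQuotient_accepts, Set.range_comp, hreach.range_eq,
    hinj.encard_image, Set.encard_univ]

theorem quotientComplexity_kstar_le {α : Type*} {n : ℕ} (hn : 2 ≤ n) {L : Language α}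
    (hL : quotientComplexity L = (n : ℕ∞)) :
    quotientComplexity (L∗) ≤ ((2 ^ (n - 1) + 2 ^ (n - 2) : ℕ) : ℕ∞) := by
  have hfin : (Set.range L.leftQuotient).Finite := Set.finite_of_encard_eq_coe hL
  have : Finite (Set.range L.leftQuotient) := hfin
  have hcard : Nat.card (Set.range L.leftQuotient) = n := by
    rw [Nat.card_coe_set_eq, Set.ncard, show (Set.range L.leftQuotient).encard = n from hL]
    rfl
  -- The states of `L.toDFA` are the quotients of `L`. If its start is the only possible accepting
  -- state, every `u ∈ L` has quotient `L`; then `L` is closed under concatenation, and it is empty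
  -- unless it contains `[]`.
  by_cases h : ∃ f ∈ L.toDFA.accept, f ≠ L.toDFA.start
  · obtain ⟨f, hf, hfs⟩ := h
    have := L.toDFA.quotientComplexity_kstar_le hf hfs
    rwa [Language.accepts_toDFA, hcard] at this
  · push Not at h
    have hq : ∀ u ∈ L, L.leftQuotient u = L := by
      intro u hu
      exact congrArg Subtype.val (h ⟨_, u, rfl⟩ (by simpa using hu))
    by_cases h0 : [] ∈ L
    · have hstar : L∗ = L := by
        refine le_antisymm ?_ le_kstar
        rintro _ ⟨S, rfl, hS⟩
        induction S with
        | nil => exact h0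
        | cons u S ih =>
          change S.flatten ∈ L.leftQuotient u
          rw [hq u (hS u (by simp))]
          exact ih fun y hy => hS y (by simp [hy])
      rw [hstar, hL]
      norm_cast
      have := (n - 1).lt_two_pow_self
      have := Nat.one_le_two_pow (n := n - 2)
      omega
    · have hL0 : L = 0 := by
        ext u
        refine ⟨fun hu => h0 ?_, fun hu => hu.elim⟩
        rw [← hq u hu]
        simpa using hu
      rw [hL0, quotientComplexity_zero] at hL
      norm_cast at hL
      omega

instance : Finite Letter :=
  .of_surjective (fun i : Fin 4 => ![Letter.a, Letter.b, Letter.c, Letter.d] i) fun x => by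
    cases x
    exacts [⟨0, rfl⟩, ⟨1, rfl⟩, ⟨2, rfl⟩, ⟨3, rfl⟩]

/-! ### The witness automaton for `n ≥ 3`, with states counted from `0`. -/

section Witness

variable {n : ℕ} (hn : 3 ≤ n)

theorem starWitness_step_c_val (i : Fin n) : ((starWitness n hn).step i Letter.c).val =
    if i.val = n - 1 then i.val else i.val - 1 := by
  simp only [starWitness, starWitnessStep]
  split_ifs <;> rfl

theorem starWitness_isAperiodic : IsAperiodicDFA (starWitness n hn) := by
  refine IsAperiodicDFA.of_monotone fun x i j hij => ?_
  have hi := i.isLt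
  have hj := j.isLt
  have hij : i.val ≤ j.val := hij
  rw [Fin.le_def]
  cases x
  · change min (i.val + 1) (n - 1) ≤ min (j.val + 1) (n - 1)
    omega
  · change i.val - 1 ≤ j.val - 1
    omega
  · simp only [starWitness_step_c_val]
    split_ifs <;> omega
  · exact le_rfl

theorem starWitness_evalFrom_replicate_a (i : Fin n) (k : ℕ) :
    ((starWitness n hn).evalFrom i (List.replicate k Letter.a)).val = min (i.val + k) (n - 1) := by
  induction k generalizing i with
  | zero => have := i.isLt; simp; omega
  | succ k ih =>
    rw [List.replicate_succ, DFA.evalFrom_cons, ih]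
    simp only [starWitness, starWitnessStep]
    omega

theorem mem_accept_starWitness {i : Fin n} : i ∈ (starWitness n hn).accept ↔ i.val = n - 2 := by
  simp [starWitness, Fin.ext_iff]

theorem quotientComplexity_starWitness :
    quotientComplexity (starWitness n hn).accepts = (n : ℕ∞) := by
  rw [DFA.quotientComplexity_eq, ENat.card_eq_coe_fintype_card, Fintype.card_fin]
  · intro i
    refine ⟨List.replicate i.val Letter.a, Fin.ext ?_⟩
    rw [DFA.eval, starWitness_evalFrom_replicate_a]
    have := i.isLt
    simp only [starWitness]
    omega
  · intro i j hij
    by_contra hne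
    wlog hlt : i < j generalizing i j
    · exact this hij.symm (Ne.symm hne) (lt_of_le_of_ne (not_lt.1 hlt) (Ne.symm hne))
    -- This power of `a` takes `i` to the accepting state `n - 2`, and the larger state `j` past it
    -- to `n - 1`.
    have h := Set.ext_iff.1 hij (List.replicate (n - 2 - i.val) Letter.a)
    change (starWitness n hn).evalFrom i _ ∈ (starWitness n hn).accept ↔
      (starWitness n hn).evalFrom j _ ∈ (starWitness n hn).accept at h
    rw [mem_accept_starWitness, mem_accept_starWitness, starWitness_evalFrom_replicate_a,
      starWitness_evalFrom_replicate_a] at h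
    have := j.isLt
    have : i.val < j.val := hlt
    omega

theorem mem_iterSubset_starWitness_a {T : Set (Fin n)} {i : Fin n} :
    i ∈ (starWitness n hn).iterSubset.step T Letter.a ↔
      (∃ j ∈ T, j.val + 1 = i.val) ∨ (i.val = n - 1 ∧ ∃ j ∈ T, j.val = n - 1) ∨
        (i.val = 0 ∧ ∃ j ∈ T, j.val = n - 3) := by
  have hi := i.isLt
  rw [DFA.mem_iterSubset_step]
  simp only [mem_accept_starWitness]
  simp only [starWitness, starWitnessStep, Fin.ext_iff]
  constructor
  · rintro (⟨j, hj, h⟩ | ⟨h, j, hj, h'⟩)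
    · have := j.isLt
      by_cases hjn : j.val = n - 1
      · exact Or.inr (Or.inl ⟨by omega, j, hj, hjn⟩)
      · exact Or.inl ⟨j, hj, by omega⟩
    · exact Or.inr (Or.inr ⟨h, j, hj, by omega⟩)
  · rintro (⟨j, hj, h⟩ | ⟨h, j, hj, h'⟩ | ⟨h, j, hj, h'⟩)
    · exact Or.inl ⟨j, hj, by omega⟩
    · exact Or.inl ⟨j, hj, by omega⟩
    · exact Or.inr ⟨h, j, hj, by omega⟩

theorem mem_iterSubset_starWitness_b {T : Set (Fin n)} {i : Fin n} :
    i ∈ (starWitness n hn).iterSubset.step T Letter.b ↔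
      (∃ j ∈ T, j.val = i.val + 1) ∨ (i.val = 0 ∧ ∃ j ∈ T, j.val = 0 ∨ j.val = n - 1) := by
  have hi := i.isLt
  rw [DFA.mem_iterSubset_step]
  simp only [mem_accept_starWitness]
  simp only [starWitness, starWitnessStep, Fin.ext_iff]
  constructor
  · rintro (⟨j, hj, h⟩ | ⟨h, j, hj, h'⟩)
    · by_cases hj0 : j.val = 0
      · exact Or.inr ⟨by omega, j, hj, Or.inl hj0⟩
      · exact Or.inl ⟨j, hj, by omega⟩
    · exact Or.inr ⟨h, j, hj, by omega⟩
  · rintro (⟨j, hj, h⟩ | ⟨h, j, hj, h' | h'⟩)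
    · exact Or.inl ⟨j, hj, by omega⟩
    · exact Or.inl ⟨j, hj, by omega⟩
    · exact Or.inr ⟨h, j, hj, by omega⟩

/-- No state is sent to `n - 2` by `c`, so reading `c` never adds the initial state. -/
theorem mem_iterSubset_starWitness_c {T : Set (Fin n)} {i : Fin n} :
    i ∈ (starWitness n hn).iterSubset.step T Letter.c ↔
      (i.val < n - 2 ∧ ∃ j ∈ T, j.val = i.val + 1) ∨ (i.val = 0 ∧ ∃ j ∈ T, j.val = 0) ∨
        (i.val = n - 1 ∧ ∃ j ∈ T, j.val = n - 1) := by
  have hi := i.isLt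
  rw [DFA.mem_iterSubset_step]
  simp only [mem_accept_starWitness, Fin.ext_iff, starWitness_step_c_val]
  constructor
  · rintro (⟨j, hj, h⟩ | ⟨h, j, hj, h'⟩)
    · have := j.isLt
      split_ifs at h with hjn
      · exact Or.inr (Or.inr ⟨by omega, j, hj, hjn⟩)
      · by_cases hj0 : j.val = 0
        · exact Or.inr (Or.inl ⟨by omega, j, hj, hj0⟩)
        · exact Or.inl ⟨by omega, j, hj, by omega⟩
    · have := j.isLt
      split_ifs at h' <;> omega
  · rintro (⟨h, j, hj, h'⟩ | ⟨h, j, hj, h'⟩ | ⟨h, j, hj, h'⟩)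
    · exact Or.inl ⟨j, hj, by rw [if_neg (by omega)]; omega⟩
    · exact Or.inl ⟨j, hj, by rw [if_neg (by omega)]; omega⟩
    · exact Or.inl ⟨j, hj, by rw [if_pos (by omega)]; omega⟩

theorem mem_iterSubset_starWitness_d {T : Set (Fin n)} {i : Fin n} :
    i ∈ (starWitness n hn).iterSubset.step T Letter.d ↔ i.val = n - 1 ∧ T.Nonempty := by
  rw [DFA.mem_iterSubset_step]
  simp only [mem_accept_starWitness]
  simp only [starWitness, starWitnessStep, Fin.ext_iff]
  constructor
  · rintro (⟨j, hj, h⟩ | ⟨h, j, hj, h'⟩)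
    · exact ⟨h.symm, j, hj⟩
    · omega
  · rintro ⟨h, j, hj⟩
    exact Or.inl ⟨j, hj, h.symm⟩

theorem mem_acceptsFrom_iterSubset_starWitness {T : Set (Fin n)} {w : List Letter} :
    w ∈ (starWitness n hn).iterSubset.acceptsFrom T ↔
      ⟨n - 2, by omega⟩ ∈ (starWitness n hn).iterSubset.evalFrom T w := by
  change (∃ q ∈ _, q ∈ (starWitness n hn).accept) ↔ _
  simp [starWitness]

theorem replicate_a_mem_acceptsFrom {T : Set (Fin n)} (k : ℕ) (hk : k ≤ n - 2) :
    List.replicate k Letter.a ∈ (starWitness n hn).iterSubset.acceptsFrom T ↔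
      ⟨n - 2 - k, by omega⟩ ∈ T := by
  induction k generalizing T with
  | zero => exact mem_acceptsFrom_iterSubset_starWitness hn
  | succ k ih =>
    change List.replicate k Letter.a ∈
      (starWitness n hn).iterSubset.acceptsFrom ((starWitness n hn).iterSubset.step T Letter.a) ↔ _
    rw [ih (by omega), mem_iterSubset_starWitness_a]
    constructor
    · rintro (⟨j, hj, h⟩ | ⟨h, -⟩ | ⟨h, -⟩)
      · convert hj using 1
        exact Fin.ext (by simp only [] at h ⊢; omega)
      · simp only [] at h; omega
      · simp only [] at h; omega
    · exact fun h => Or.inl ⟨_, h, by simp only []; omega⟩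

theorem b_mem_acceptsFrom {T : Set (Fin n)} :
    [Letter.b] ∈ (starWitness n hn).iterSubset.acceptsFrom T ↔ ⟨n - 1, by omega⟩ ∈ T := by
  rw [mem_acceptsFrom_iterSubset_starWitness, DFA.evalFrom_singleton, mem_iterSubset_starWitness_b]
  constructor
  · rintro (⟨j, hj, h⟩ | ⟨h, -⟩)
    · convert hj using 1
      exact Fin.ext (by simp only [] at h ⊢; omega)
    · simp only [] at h; omega
  · exact fun h => Or.inl ⟨_, h, by simp only []; omega⟩

/-- Membership of each state is tested by one word: `b` for the last state, a power of `a` for every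
other. -/
theorem acceptsFrom_iterSubset_starWitness_injective :
    Function.Injective (starWitness n hn).iterSubset.acceptsFrom := by
  intro T T' h
  ext i
  have hi := i.isLt
  by_cases hin : i.val = n - 1
  · rw [show i = ⟨n - 1, by omega⟩ from Fin.ext hin, ← b_mem_acceptsFrom hn, h, b_mem_acceptsFrom]
  · rw [show i = ⟨n - 2 - (n - 2 - i.val), by omega⟩ from Fin.ext (by simp only []; omega),
      ← replicate_a_mem_acceptsFrom hn _ (by omega), h, replicate_a_mem_acceptsFrom hn _ (by omega)]

/-- A set accepting the empty word contains `n - 2`, and `ab` leads from there to `n - 1` and back,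
so `ab` is accepted. But `ab` is not in the iteration: from `0`, the letter `a` does not reach `n -
1`. -/
theorem acceptsFrom_iterSubset_starWitness_ne (T : Set (Fin n)) :
    (starWitness n hn).iterSubset.acceptsFrom T ≠ (starWitness n hn).accepts∗ := by
  intro h
  have h0 : ⟨n - 2, by omega⟩ ∈ T := by
    rw [← DFA.evalFrom_nil (starWitness n hn).iterSubset T,
      ← mem_acceptsFrom_iterSubset_starWitness, h]
    exact Language.nil_mem_kstar _
  have hab : ∀ T : Set (Fin n), [Letter.a, Letter.b] ∈
      (starWitness n hn).iterSubset.acceptsFrom T ↔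
        ⟨n - 1, by omega⟩ ∈ (starWitness n hn).iterSubset.step T Letter.a := fun T =>
    b_mem_acceptsFrom hn
  have h1 : [Letter.a, Letter.b] ∈ (starWitness n hn).iterSubset.acceptsFrom T := by
    rw [hab, mem_iterSubset_starWitness_a]
    exact Or.inl ⟨_, h0, by simp only []; omega⟩
  rw [h, DFA.mem_kstar_iff _ (by simp)] at h1
  have h2 := (hab _).1 h1
  rw [mem_iterSubset_starWitness_a] at h2
  have hstart : ∀ j ∈ (starWitness n hn).iterSubset.start, j.val = 0 := by
    rintro j rfl
    rfl
  rcases h2 with ⟨j, hj, h⟩ | ⟨-, j, hj, h⟩ | ⟨h, -⟩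
  · have := hstart j hj; simp only [] at h; omega
  · have := hstart j hj; omega
  · simp only [] at h; omega

/-- The set `U` of numbers is, on the states of the witness, reached in the subset automaton by
some nonempty word. -/
def StarReachable (U : Finset ℕ) : Prop :=
  ∃ w : List Letter, w ≠ [] ∧
    ∀ i : Fin n, i ∈ (starWitness n hn).iterSubset.eval w ↔ i.val ∈ U

namespace StarReachable

variable {hn} {U V : Finset ℕ}

theorem exists_val {T : Set (Fin n)} (hT : ∀ i : Fin n, i ∈ T ↔ i.val ∈ U) {k : ℕ} (hk : k < n) :
    (∃ j ∈ T, j.val = k) ↔ k ∈ U :=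
  ⟨fun ⟨j, hj, h⟩ => h ▸ (hT j).1 hj, fun h => ⟨⟨k, hk⟩, (hT _).2 h, rfl⟩⟩

theorem a (hU : StarReachable hn U) (hV : ∀ i < n, i ∈ V ↔
    (0 < i ∧ i - 1 ∈ U) ∨ (i = n - 1 ∧ n - 1 ∈ U) ∨ (i = 0 ∧ n - 3 ∈ U)) :
    StarReachable hn V := by
  obtain ⟨w, -, hw⟩ := hU
  refine ⟨w ++ [Letter.a], by simp, fun i => ?_⟩
  have hi := i.isLt
  rw [DFA.eval_append_singleton, mem_iterSubset_starWitness_a, exists_val hw (by omega),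
    exists_val hw (by omega), hV i hi]
  refine or_congr_left ?_
  rw [← exists_val hw (show i.val - 1 < n by omega)]
  constructor
  · rintro ⟨j, hj, h⟩
    exact ⟨by omega, j, hj, by omega⟩
  · rintro ⟨h, j, hj, h'⟩
    exact ⟨j, hj, by omega⟩

theorem b (hU : StarReachable hn U) (hV : ∀ i < n, i ∈ V ↔
    (i + 1 < n ∧ i + 1 ∈ U) ∨ (i = 0 ∧ (0 ∈ U ∨ n - 1 ∈ U))) :
    StarReachable hn V := by
  obtain ⟨w, -, hw⟩ := hU
  refine ⟨w ++ [Letter.b], by simp, fun i => ?_⟩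
  have hi := i.isLt
  rw [DFA.eval_append_singleton, mem_iterSubset_starWitness_b, hV i hi,
    ← exists_val hw (show 0 < n by omega), ← exists_val hw (show n - 1 < n by omega)]
  have h : (∃ j ∈ (starWitness n hn).iterSubset.eval w, j.val = i.val + 1) ↔
      i.val + 1 < n ∧ i.val + 1 ∈ U := by
    constructor
    · rintro ⟨j, hj, h⟩
      exact ⟨h ▸ j.isLt, h ▸ (hw j).1 hj⟩
    · rintro ⟨h, h'⟩
      exact (exists_val hw h).2 h'
  rw [h]
  simp only [and_or_left, exists_or]

theorem c (hU : StarReachable hn U) (hV : ∀ i < n, i ∈ V ↔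
    (i < n - 2 ∧ i + 1 ∈ U) ∨ (i = 0 ∧ 0 ∈ U) ∨ (i = n - 1 ∧ n - 1 ∈ U)) :
    StarReachable hn V := by
  obtain ⟨w, -, hw⟩ := hU
  refine ⟨w ++ [Letter.c], by simp, fun i => ?_⟩
  have hi := i.isLt
  rw [DFA.eval_append_singleton, mem_iterSubset_starWitness_c, hV i hi,
    exists_val hw (show 0 < n by omega), exists_val hw (show n - 1 < n by omega)]
  refine or_congr_left (and_congr_right fun h => ?_)
  rw [exists_val hw (by omega)]

theorem singleton_last : StarReachable hn {n - 1} := by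
  refine ⟨[Letter.d], by simp, fun i => ?_⟩
  rw [DFA.eval_singleton, mem_iterSubset_starWitness_d, Finset.mem_singleton]
  exact and_iff_left ⟨_, rfl⟩

theorem insert_last_of_zero_mem {S : Finset ℕ} {k : ℕ}
    (ih : ∀ {S : Finset ℕ}, (∀ i ∈ S, i < n - 2) → S.card ≤ k → StarReachable hn (insert (n - 1) S))
    (hS : ∀ i ∈ S, i < n - 2) (hk : S.card ≤ k + 1) (hi : 0 ∈ S) :
    StarReachable hn (insert (n - 1) S) := by
  have hle : (S.erase 0).card ≤ k := by rw [Finset.card_erase_of_mem hi]; omega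
  by_cases h3 : n = 3
  · have hS0 : ∀ i, i ∈ S ↔ i = 0 :=
      fun i => ⟨fun h => by have := hS i h; omega, fun h => h ▸ hi⟩
    -- For `n = 3` the sets along `dbac` are `{2}`, `{0, 1}`, `{0, 1, 2}`, `{0, 2}`.
    have h1 : StarReachable hn {0, 1} := by
      refine singleton_last.b fun i hin => ?_
      simp only [Finset.mem_insert, Finset.mem_singleton, or_true, and_true]
      omega
    have h2 : StarReachable hn {0, 1, 2} := by
      refine h1.a fun i hin => ?_
      simp only [Finset.mem_insert, Finset.mem_singleton]
      omega
    refine h2.c fun i hin => ?_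
    simp only [Finset.mem_insert, Finset.mem_singleton, hS0]
    omega
  · by_cases hl : n - 3 ∈ S
    -- The word `ac` inserts `0`: under `a` the state `n - 3` becomes accepting and adds `0`, and
    -- `c` shifts the rest back while keeping `0` and `n - 1`.
    · have h0 := ih (fun i h => hS i (Finset.mem_of_mem_erase h)) hle
      have h1 : StarReachable hn (insert 0 (insert (n - 1) ((S.erase 0).image (· + 1)))) := by
        refine h0.a fun i hin => ?_
        simp only [Finset.mem_insert, Finset.mem_image, Finset.mem_erase]
        grind
      refine h1.c fun i hin => ?_
      simp only [Finset.mem_insert, Finset.mem_image, Finset.mem_erase]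
      grind
    -- The word `bac` is applied to the set shifted up by one: `b` makes `n - 1` accepting, which
    -- adds `0`; `a` restores `n - 1` without adding `0` again, as `n - 3` is absent; `c` shifts
    -- down the rest.
    · have h0 := ih (S := (S.erase 0).image (· + 1)) (fun i h => by
          simp only [Finset.mem_image, Finset.mem_erase] at h
          obtain ⟨j, ⟨-, hj⟩, rfl⟩ := h
          have := hS j hj
          have : j ≠ n - 3 := fun h => hl (h ▸ hj)
          omega) (Finset.card_image_le.trans hle)
      have h1 : StarReachable hn (insert 0 (insert (n - 2) (S.erase 0))) := by
        refine h0.b fun i hin => ?_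
        simp only [Finset.mem_insert, Finset.mem_image, Finset.mem_erase]
        grind
      have h2 : StarReachable hn
          (insert 1 (insert (n - 1) ((S.erase 0).image (· + 1)))) := by
        refine h1.a fun i hin => ?_
        simp only [Finset.mem_insert, Finset.mem_image, Finset.mem_erase]
        grind
      refine h2.c fun i hin => ?_
      simp only [Finset.mem_insert, Finset.mem_image, Finset.mem_erase]
      grind

/-- Outer induction on a bound for the size of `S`, inner induction on an element of `S`: either `0`
or `1` can be inserted into a smaller set, or `S` is the shift by `a` of a set with a smaller chosen
element. -/
theorem insert_last {S : Finset ℕ} (hS : ∀ i ∈ S, i < n - 2) :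
    StarReachable hn (insert (n - 1) S) := by
  obtain ⟨k, hk⟩ : ∃ k, S.card ≤ k := ⟨_, le_rfl⟩
  induction k generalizing S with
  | zero =>
    rw [Finset.card_eq_zero.1 (Nat.le_zero.1 hk)]
    exact singleton_last
  | succ k ih =>
  rcases S.eq_empty_or_nonempty with rfl | ⟨i, hi⟩
  · exact singleton_last
  induction i generalizing S with
  | zero => exact insert_last_of_zero_mem ih hS hk hi
  | succ i ihi =>
    by_cases h0 : 0 ∈ S
    · exact insert_last_of_zero_mem ih hS hk h0
    by_cases h1 : 1 ∈ S
    -- The word `ba` inserts `1`: under `b` the state `n - 1` becomes accepting and adds `0`, which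
    -- `a` moves to `1` while shifting everything else back.
    · have hle : (S.erase 1).card ≤ k := by rw [Finset.card_erase_of_mem h1]; omega
      have h2 := ih (fun i h => hS i (Finset.mem_of_mem_erase h)) hle
      have h3 : StarReachable hn (insert 0 (insert (n - 2) ((S.erase 1).image (· - 1)))) := by
        refine h2.b fun i hin => ?_
        simp only [Finset.mem_insert, Finset.mem_image, Finset.mem_erase]
        grind
      refine h3.a fun i hin => ?_
      clear ih ihi hk hle h2 h3
      simp only [Finset.mem_insert, Finset.mem_image, Finset.mem_erase]
      grind (splits := 20)
    · have h2 := ihi (S := S.image (· - 1)) (fun j h => by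
        obtain ⟨l, hl, rfl⟩ := Finset.mem_image.1 h
        have := hS l hl
        omega) (Finset.card_image_le.trans hk) (Finset.mem_image.2 ⟨_, hi, rfl⟩)
      refine h2.a fun i hin => ?_
      simp only [Finset.mem_insert, Finset.mem_image]
      grind

theorem of_last_mem {T : Finset ℕ} (hT : n - 1 ∈ T) (h : n - 2 ∈ T → 0 ∈ T) :
    StarReachable hn T := by
  by_cases h2 : n - 2 ∈ T
  -- The shifted set contains `n - 3`, so `a` adds `0`, as the guard on `T` requires.
  · refine (insert_last (S := (Finset.range (n - 2)).filter (· + 1 ∈ T)) (by simp; omega)).a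
      fun i hi => ?_
    simp only [Finset.mem_insert, Finset.mem_filter, Finset.mem_range]
    grind
  · obtain ⟨w, hw, hT'⟩ := insert_last (hn := hn) (S := (Finset.range (n - 2)).filter (· ∈ T))
      (by simp; omega)
    refine ⟨w, hw, fun i => ?_⟩
    rw [hT']
    simp only [Finset.mem_insert, Finset.mem_filter, Finset.mem_range]
    have := i.isLt
    grind

/-- The letter `b` undoes an upward shift and keeps `0`, so `T` is reached from its upward shift
with `0` inserted. Repeating this brings some element to `n - 1`, where `of_last_mem` applies. -/
theorem of_zero_mem {T : Finset ℕ} (hT : 0 ∈ T) : StarReachable hn T := by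
  have key : ∀ k, ∀ T : Finset ℕ, 0 ∈ T → (∃ i ∈ T, i < n ∧ n ≤ i + 1 + k) →
      StarReachable hn T := by
    intro k
    induction k with
    | zero =>
      rintro T hT ⟨i, hi, h1, h2⟩
      exact of_last_mem ((show i = n - 1 by omega) ▸ hi) fun _ => hT
    | succ k ih =>
      rintro T hT ⟨i, hi, h1, h2⟩
      by_cases hl : n - 1 ∈ T
      · exact of_last_mem hl fun _ => hT
      · refine (ih (insert 0 (T.image (· + 1))) (by simp) ⟨i + 1, by simp [hi], ?_, ?_⟩).b
          fun i hin => ?_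
        · have : i ≠ n - 1 := fun h => hl (h ▸ hi)
          omega
        · omega
        · simp only [Finset.mem_insert, Finset.mem_image]
          grind
  exact key n T hT ⟨0, hT, by omega, by omega⟩

theorem of_mem {T : Finset ℕ} {i : ℕ} (hi : i ∈ T) (hin : i < n) (h : n - 2 ∈ T → 0 ∈ T) :
    StarReachable hn T := by
  induction i generalizing T with
  | zero => exact of_zero_mem hi
  | succ i ih =>
    by_cases h0 : 0 ∈ T
    · exact of_zero_mem h0
    by_cases hl : n - 1 ∈ T
    · exact of_last_mem hl h
    -- Here `0`, hence also `n - 2`, is not in `T`; so `n - 3` is not in the set shifted down, and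
    -- `a` shifts it up without adding `0`.
    refine (ih (T := (Finset.range (n - 2)).filter (· + 1 ∈ T)) ?_ (by omega) ?_).a fun j hj => ?_
    · simp only [Finset.mem_filter, Finset.mem_range]
      grind
    · simp
    · simp only [Finset.mem_filter, Finset.mem_range]
      grind

end StarReachable

theorem exists_iterSubset_starWitness_eval_eq {T : Set (Fin n)}
    (hT : T ∈ guardedSets ⟨n - 2, by omega⟩ (starWitness n hn).start) :
    ∃ w, w ≠ [] ∧ (starWitness n hn).iterSubset.eval w = T := by
  classical
  obtain ⟨⟨i, hi⟩, h⟩ := hT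
  have hU : ∀ j : Fin n, j.val ∈ (Finset.univ.filter (· ∈ T)).image Fin.val ↔ j ∈ T := by
    intro j
    simp [Fin.val_inj]
  obtain ⟨w, hw, hwU⟩ := StarReachable.of_mem (hn := hn) ((hU i).2 hi) i.isLt fun h' =>
    (hU (starWitness n hn).start).2 (h ((hU ⟨n - 2, by omega⟩).1 h'))
  exact ⟨w, hw, Set.ext fun j => (hwU j).trans (hU j)⟩

theorem quotientComplexity_kstar_starWitness :
    quotientComplexity ((starWitness n hn).accepts∗) =
      ((2 ^ (n - 1) + 2 ^ (n - 2) : ℕ) : ℕ∞) := by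
  rw [(starWitness n hn).quotientComplexity_kstar_eq (f := ⟨n - 2, by omega⟩)
    ((mem_accept_starWitness hn).2 rfl) ?_
    (fun T hT => exists_iterSubset_starWitness_eval_eq hn hT)
    (acceptsFrom_iterSubset_starWitness_injective hn).injOn
    (fun T _ => acceptsFrom_iterSubset_starWitness_ne hn T), Nat.card_fin]
  rw [Ne, Fin.ext_iff]
  simp only [starWitness]
  omega

end Witness

/-! ### The witness for `n = 2`. -/

/-- The automaton with two states that accepts the words in which the letter `a` occurs. -/
def occursA : DFA Letter Bool where
  step q x := match x with
    | .a => true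
    | _ => q
  start := false
  accept := {true}

theorem occursA_isAperiodic : IsAperiodicDFA occursA := by
  refine IsAperiodicDFA.of_monotone fun x => ?_
  cases x
  exacts [monotone_const, monotone_id, monotone_id, monotone_id]

theorem quotientComplexity_occursA : quotientComplexity occursA.accepts = 2 := by
  rw [DFA.quotientComplexity_eq, ENat.card_eq_coe_fintype_card, Fintype.card_bool]
  · rfl
  · intro q
    cases q
    exacts [⟨[], rfl⟩, ⟨[Letter.a], rfl⟩]
  · intro p q h
    have := Set.ext_iff.1 h []
    change p = true ↔ q = true at this
    exact Bool.eq_iff_iff.2 this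

theorem mem_occursA_iterSubset_accept {T : Set Bool} :
    T ∈ occursA.iterSubset.accept ↔ true ∈ T := by
  change (∃ q ∈ T, q = true) ↔ _
  simp

theorem occursA_iterSubset_step_b (T : Set Bool) :
    occursA.iterSubset.step T Letter.b = T ∪ {q | q = false ∧ true ∈ T} := by
  ext q
  rw [DFA.mem_iterSubset_step]
  change ((∃ p ∈ T, p = q) ∨ q = false ∧ ∃ p ∈ T, p = true) ↔ _
  simp

theorem quotientComplexity_kstar_occursA : quotientComplexity (occursA.accepts∗) = 3 := by
  rw [occursA.quotientComplexity_kstar_eq (f := true) rfl (by simp [occursA]) ?_ ?_ ?_,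
    Nat.card_eq_fintype_card, Fintype.card_bool]
  · rfl
  · rintro T ⟨hT, h⟩
    by_cases ht : true ∈ T
    · refine ⟨[Letter.a], by simp, ?_⟩
      have hf : false ∈ T := h ht
      ext q
      rw [DFA.eval_singleton, DFA.mem_iterSubset_step]
      change ((∃ p ∈ ({false} : Set Bool), true = q) ∨
        q = false ∧ ∃ p ∈ ({false} : Set Bool), true = true) ↔ _
      cases q <;> simp [ht, hf]
    · have hf : false ∈ T := by
        obtain ⟨q, hq⟩ := hT
        cases q
        exacts [hq, absurd hq ht]
      refine ⟨[Letter.b], by simp, ?_⟩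
      ext q
      rw [DFA.eval_singleton, occursA_iterSubset_step_b]
      change (q ∈ ({false} : Set Bool) ∨ q = false ∧ true ∈ ({false} : Set Bool)) ↔ _
      cases q <;> simp [ht, hf]
  · rintro T ⟨hT, hT'⟩ T' ⟨hS, hS'⟩ h
    have htrue : true ∈ T ↔ true ∈ T' := by
      rw [← mem_occursA_iterSubset_accept, ← mem_occursA_iterSubset_accept]
      exact Set.ext_iff.1 h []
    have hfalse : ∀ T : Set Bool, T.Nonempty → (true ∈ T → false ∈ T) → false ∈ T := by
      rintro T ⟨q, hq⟩ h
      cases q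
      exacts [hq, h hq]
    ext q
    cases q
    · exact iff_of_true (hfalse T hT hT') (hfalse T' hS hS')
    · exact htrue
  · rintro T - h
    have h0 : true ∈ T := by
      rw [← mem_occursA_iterSubset_accept]
      have : [] ∈ occursA.iterSubset.acceptsFrom T := h ▸ Language.nil_mem_kstar _
      exact this
    -- The word `b` separates: it is accepted from every set containing `true`, but is not in the
    -- iteration.
    have h1 : [Letter.b] ∈ occursA.iterSubset.acceptsFrom T := by
      rw [DFA.mem_acceptsFrom, mem_occursA_iterSubset_accept, DFA.evalFrom_singleton,
        occursA_iterSubset_step_b]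
      exact Or.inl h0
    rw [h, DFA.mem_kstar_iff _ (by simp), mem_occursA_iterSubset_accept, DFA.eval_singleton,
      occursA_iterSubset_step_b] at h1
    change true ∈ ({false} : Set Bool) ∨ true = false ∧ _ at h1
    simp at h1

/-! ### Languages with a single quotient. -/

section Trivial

variable {α : Type*}

/-- All quotients equal `L`, so whether a word lies in `L` depends only on whether the empty word
does. -/
theorem eq_zero_or_eq_top_of_quotientComplexity_eq_one {L : Language α}
    (hL : quotientComplexity L = 1) : L = 0 ∨ L = ⊤ := by
  obtain ⟨K, hK⟩ := Set.encard_eq_one.1 hL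
  have hq : ∀ w, L.leftQuotient w = L := fun w => by
    have h1 : L.leftQuotient w ∈ Set.range L.leftQuotient := ⟨w, rfl⟩
    have h2 : L.leftQuotient [] ∈ Set.range L.leftQuotient := ⟨[], rfl⟩
    rw [hK] at h1 h2
    exact h1.trans h2.symm
  have hmem : ∀ w, w ∈ L ↔ [] ∈ L := fun w => by
    conv_rhs => rw [← hq w]
    rw [Language.mem_leftQuotient, List.append_nil]
  by_cases h : [] ∈ L
  · exact Or.inr (Language.ext fun w => iff_of_true ((hmem w).2 h) trivial)
  · exact Or.inl (Language.ext fun w => iff_of_false (fun h' => h ((hmem w).1 h')) id)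

theorem quotientComplexity_top : quotientComplexity (⊤ : Language α) = 1 := by
  have h : Set.range (⊤ : Language α).leftQuotient = {⊤} := by
    ext K
    simp only [Set.mem_range, Set.mem_singleton_iff]
    have hq : ∀ w, (⊤ : Language α).leftQuotient w = ⊤ := fun w => rfl
    simp [hq, eq_comm]
  rw [quotientComplexity, h, Set.encard_singleton]

theorem quotientComplexity_one [Nonempty α] : quotientComplexity (1 : Language α) = 2 := by
  have h : Set.range (1 : Language α).leftQuotient = {1, 0} := by
    have hq : ∀ w : List α, w ≠ [] → (1 : Language α).leftQuotient w = 0 := fun w hw =>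
      Language.ext fun x => iff_of_false (fun h => hw (List.append_eq_nil_iff.1 h).1) id
    ext K
    constructor
    · rintro ⟨w, rfl⟩
      by_cases hw : w = []
      · exact Or.inl (by rw [hw, Language.leftQuotient_nil])
      · exact Or.inr (hq w hw)
    · rintro (rfl | rfl)
      · exact ⟨[], rfl⟩
      · exact ⟨[Classical.arbitrary α], hq _ (by simp)⟩
  rw [quotientComplexity, h, Set.encard_pair]
  exact fun h => Language.notMem_zero ([] : List α) (h ▸ Language.nil_mem_one)

theorem isGreatest_quotientComplexity_kstar [Nonempty α] :
    IsGreatest {k : ℕ∞ | ∃ L : Language α, IsStarFree L ∧ quotientComplexity L = 1 ∧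
      quotientComplexity (L∗) = k} 2 := by
  constructor
  · exact ⟨0, .zero, quotientComplexity_zero, by rw [kstar_zero, quotientComplexity_one]⟩
  · rintro _ ⟨L, -, hL, rfl⟩
    rcases eq_zero_or_eq_top_of_quotientComplexity_eq_one hL with rfl | rfl
    · rw [kstar_zero, quotientComplexity_one]
    · rw [show (⊤ : Language α)∗ = ⊤ from top_le_iff.1 le_kstar, quotientComplexity_top]
      norm_num

end Trivial

theorem theorem4 :
    -- for every `n ≥ 2` some quaternary star-free language meets the bound
    (∀ n : ℕ, 2 ≤ n → ∃ L : Language Letter, IsStarFree L ∧ quotientComplexity L = (n : ℕ∞) ∧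
      quotientComplexity (L∗) = ((2 ^ (n - 1) + 2 ^ (n - 2) : ℕ) : ℕ∞)) ∧
    -- for `n ≥ 3` the language of the aperiodic automaton `D_n(a, b, c, d)` is such a language
    (∀ (n : ℕ) (hn : 3 ≤ n), IsAperiodicDFA (starWitness n hn) ∧
      IsStarFree (starWitness n hn).accepts ∧
      quotientComplexity (starWitness n hn).accepts = (n : ℕ∞) ∧
      quotientComplexity ((starWitness n hn).accepts∗) =
        ((2 ^ (n - 1) + 2 ^ (n - 2) : ℕ) : ℕ∞)) ∧
    -- for `n ≥ 2` this number is an upper bound for all regular languages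
    (∀ (α : Type*) [Finite α] [Nonempty α] (n : ℕ), 2 ≤ n →
      ∀ L : Language α, L.IsRegular → quotientComplexity L = (n : ℕ∞) →
        quotientComplexity (L∗) ≤ ((2 ^ (n - 1) + 2 ^ (n - 2) : ℕ) : ℕ∞)) ∧
    -- for `n = 1` the tight upper bound is `2`
    (∀ (α : Type*) [Finite α] [Nonempty α],
      IsGreatest {k : ℕ∞ | ∃ L : Language α, IsStarFree L ∧ quotientComplexity L = 1 ∧
        quotientComplexity (L∗) = k} 2) := by
  refine ⟨fun n hn => ?_, fun n hn => ⟨starWitness_isAperiodic hn,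
    (starWitness_isAperiodic hn).isStarFree_accepts, quotientComplexity_starWitness hn,
    quotientComplexity_kstar_starWitness hn⟩, fun α _ _ n hn L _ hL =>
    quotientComplexity_kstar_le hn hL, fun α _ _ => isGreatest_quotientComplexity_kstar⟩
  rcases hn.eq_or_lt with rfl | hn
  · exact ⟨_, occursA_isAperiodic.isStarFree_accepts, quotientComplexity_occursA,
      quotientComplexity_kstar_occursA⟩
  · exact ⟨_, (starWitness_isAperiodic hn).isStarFree_accepts, quotientComplexity_starWitness hn,
      quotientComplexity_kstar_starWitness hn⟩
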